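/- Let $V_n=\mathbb{C}^n$ with basis of colors $|1\rangle,\dots,|n\rangle$, let $N$ be the number of sites and $\mathbb{V}^N=V_n^{\otimes N}$, with basis $|k_1\dots k_N\rangle$ and the tensor product action of $\mathfrak{sl}(n,\mathbb{C})$. Let $D(N)=N-1$ for an open chain and $D(N)=N$ for a periodic chain (ring), where site $N+1$ is identified with site $1$, and let $J_{l\,l+1}>0$ for $1\le l\le D(N)$. Consider the Hamiltonian $$\widehat{\mathcal H}=\sum_{l=1}^{D(N)}J_{l\,l+1}P_{l\,l+1},$$ where $P_{ij}$ exchanges the colors of sites $i$ and $j$, or the Hamiltonian $$\mathcal H=\sum_{l=1}^{D(N)}\sum_{a=1}^{n^2-1}J_{l\,l+1}X^a_{l}X^a_{l+1},$$ where $X^1,\dots,X^{n^2-1}$ are traceless Hermitian $n\times n$ matrices with $\operatorname{tr}(X^aX^b)=\delta_{ab}$ and $X^a_l$ is $X^a$ acting at site $l$. (For $N\ge2$ these differ by a scalar.) For integers $N_1,\dots,N_n\ge 0$ with $N_1+\dots+N_n=N$, let $\mathbb{V}^N_{N_1\dots N_n}$ be the weight subspace spanned by the states $|k_1\dots k_N\rangle$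 that contain each color $i$ exactly $N_i$ times, and let $\Omega_{N_1\dots N_n}$ be a relative ground state, that is, an eigenvector, belonging to the least eigenvalue, of the restriction of the Hamiltonian to $\mathbb{V}^N_{N_1\dots N_n}$. For a Young diagram $\mathbb{Y}$ with $N$ boxes and at most $n$ rows, distribute the $N$ sites among the boxes, and apply to $\mathbb{V}^N$ the symmetrization over the sites of each row followed by the antisymmetrization over the sites of each column; the image is an irreducible $\mathfrak{sl}(n,\mathbb{C})$-subrepresentation, whose equivalence class depends only on $\mathbb{Y}$. The multiplet sector $\mathbb{V}^N_{\mathbb{Y}}$ is the sum of all $\mathfrak{sl}(n,\mathbb{C})$-subrepresentations of $\mathbb{V}^N$ in this equivalence class. Let $p$ be a permutation of $\{1,\dots,n\}$ with $N_{p_1}\ge\dots\ge N_{p_n}$, let $\nu$ be the number of nonzero $N_i$, and let $\mathbb{Y}=\mathbb{Y}[N_{p_1},\dots,N_{p_\nu}]$ be the Young diagram whose $i$-th row has $N_{p_i}$ boxes, $1\le i\le\nu$. For the open chain, $\Omega_{N_1\dots N_n}\in\mathbb{V}^N_{\mathbb{Y}}$. For the periodic chain, $\Omega_{N_1\dots N_n}\in\mathbb{V}^N_{\mathbb{Y}}$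 if all nonzero $N_i$ have the same parity. -/

import Mathlib

noncomputable section

namespace SuChain

/-- The space of states `V_n ⊗ ⋯ ⊗ V_n` (`N` factors, `V_n = ℂⁿ`), in coordinates: the tensor
`∑ ψ(k₁,…,k_N) |k₁ … k_N⟩` is the function `ψ`.  Sites and colors are numbered from `0`. -/
abbrev StateSpace (n N : ℕ) : Type := (Fin N → Fin n) → ℂ

/-- The basic state `|k₁ … k_N⟩`. -/
def ket {n N : ℕ} (k : Fin N → Fin n) : StateSpace n N := Pi.single k 1

/-- The operator `x_l = 1 ⊗ ⋯ ⊗ x ⊗ ⋯ ⊗ 1`, with the `n × n` matrix `x` acting on the factor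
attached to the site `l`. -/
def siteOp {n N : ℕ} (l : Fin N) (x : Matrix (Fin n) (Fin n) ℂ) :
    StateSpace n N →ₗ[ℂ] StateSpace n N where
  toFun ψ k := ∑ j, x (k l) j * ψ (Function.update k l j)
  map_add' ψ φ := by
    funext k
    simp [mul_add, Finset.sum_add_distrib]
  map_smul' c ψ := by
    funext k
    simp only [Pi.smul_apply, smul_eq_mul, RingHom.id_apply, Finset.mul_sum]
    exact Finset.sum_congr rfl fun j _ => by ring

/-- The tensor product action `ρ^N(x) = ∑_l x_l`. -/
def tensorRep {n N : ℕ} (x : Matrix (Fin n) (Fin n) ℂ) :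
    StateSpace n N →ₗ[ℂ] StateSpace n N :=
  ∑ l, siteOp l x

/-- The permutation `τ` of the sites, acting on states: the color at the site `l` is moved to the
site `τ l`, i.e. `|k⟩ ↦ |k ∘ τ⁻¹⟩`. -/
def permOp {n N : ℕ} (τ : Equiv.Perm (Fin N)) : StateSpace n N →ₗ[ℂ] StateSpace n N :=
  LinearMap.funLeft ℂ ℂ fun k : Fin N → Fin n => k ∘ τ

/-! ### Chains -/

/-- Boundary conditions of a chain. -/
inductive Boundary
  | openChain
  | periodic

/-- The number of nearest-neighbor bonds of an `N`-site chain: `N - 1` for open chains, `N` for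
periodic ones. -/
def numBonds : Boundary → ℕ → ℕ
  | .openChain, N => N - 1
  | .periodic, N => N

theorem numBonds_le (b : Boundary) (N : ℕ) : numBonds b N ≤ N := by
  cases b
  · exact Nat.sub_le N 1
  · exact le_rfl

/-- The first site of the `l`-th bond. -/
def leftSite {b : Boundary} {N : ℕ} (l : Fin (numBonds b N)) : Fin N :=
  ⟨l, l.2.trans_le (numBonds_le b N)⟩

/-- The second site of the `l`-th bond: the next one, where on a ring the last site is followed by
the first one (on an open chain the reduction modulo `N` changes nothing). -/
def rightSite {b : Boundary} {N : ℕ} (l : Fin (numBonds b N)) : Fin N :=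
  ⟨((l : ℕ) + 1) % N, Nat.mod_lt _ (Nat.zero_lt_of_lt (leftSite l).2)⟩

/-- The matrices `X^a`, `1 ≤ a ≤ n² - 1`, are Hermitian, traceless and satisfy
`tr (X^a X^b) = δ_{ab}`: the `i X^a` form a basis of `su(n)`, with the usual normalization. -/
structure IsSuBasis {n : ℕ} (X : Fin (n ^ 2 - 1) → Matrix (Fin n) (Fin n) ℂ) : Prop where
  isHermitian : ∀ a, (X a).IsHermitian
  trace_eq_zero : ∀ a, (X a).trace = 0
  trace_mul : ∀ a b, (X a * X b).trace = if a = b then 1 else 0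

/-- The Hamiltonian `∑_l ∑_a J_{l,l+1} X^a_l X^a_{l+1}`. -/
def suHamiltonian {n N : ℕ} {b : Boundary} (X : Fin (n ^ 2 - 1) → Matrix (Fin n) (Fin n) ℂ)
    (J : Fin (numBonds b N) → ℝ) : StateSpace n N →ₗ[ℂ] StateSpace n N :=
  ∑ l, ∑ a, (J l : ℂ) • (siteOp (leftSite l) (X a) ∘ₗ siteOp (rightSite l) (X a))

/-- The Hamiltonian in the permutation form, `∑_l J_{l,l+1} P_{l,l+1}`, where `P_{ij}` exchanges
the colors of the sites `i` and `j`. -/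
def exchangeHamiltonian (n : ℕ) {N : ℕ} {b : Boundary} (J : Fin (numBonds b N) → ℝ) :
    StateSpace n N →ₗ[ℂ] StateSpace n N :=
  ∑ l, (J l : ℂ) • permOp (Equiv.swap (leftSite l) (rightSite l))

/-! ### Weight subspaces and relative ground states -/

/-- The weight subspace spanned by the basic states with exactly `m i` sites of color `i`, for
every color `i`. -/
def weightSpace {n : ℕ} (N : ℕ) (m : Fin n → ℕ) : Submodule ℂ (StateSpace n N) :=
  Submodule.span ℂ
    {ψ | ∃ k : Fin N → Fin n, (∀ i, (Finset.univ.filter fun l => k l = i).card = m i) ∧ ψ = ket k}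

/-- `Ω` is a minimal energy state of the restriction of the Hamiltonian `H` to the weight subspace
with color multiplicities `m`: an eigenvector in it, for the least eigenvalue. -/
def IsRelativeGroundState {n N : ℕ} (H : StateSpace n N →ₗ[ℂ] StateSpace n N) (m : Fin n → ℕ)
    (Ω : StateSpace n N) : Prop :=
  ∃ E : ℝ, Ω ∈ weightSpace N m ∧ Ω ≠ 0 ∧ H Ω = (E : ℂ) • Ω ∧
    ∀ E' : ℝ, ∀ ψ ∈ weightSpace N m, ψ ≠ 0 → H ψ = (E' : ℂ) • ψ → E ≤ E'

/-! ### Multiplet sectors -/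

/-- A distribution of the `N` sites among the boxes of `Y`, one site in each box.  The box
`(i, j)` is in the row `i` and in the column `j`. -/
abbrev IndexedTableau (N : ℕ) (Y : YoungDiagram) : Type := Fin N ≃ Y.cells

/-- Symmetrization over the sites of each row. -/
def rowSymmetrizer {N : ℕ} (n : ℕ) {Y : YoungDiagram} (t : IndexedTableau N Y) :
    StateSpace n N →ₗ[ℂ] StateSpace n N :=
  ∑ τ : Equiv.Perm (Fin N) with ∀ l, (t (τ l)).1.1 = (t l).1.1, permOp τ

/-- Antisymmetrization over the sites of each column. -/
def colAntisymmetrizer {N : ℕ} (n : ℕ) {Y : YoungDiagram} (t : IndexedTableau N Y) :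
    StateSpace n N →ₗ[ℂ] StateSpace n N :=
  ∑ τ : Equiv.Perm (Fin N) with ∀ l, (t (τ l)).1.2 = (t l).1.2,
    ((Equiv.Perm.sign τ : ℤ) : ℂ) • permOp τ

/-- The multiplet constructed from an indexed Young tableau: symmetrize over the rows, then
antisymmetrize over the columns. -/
def youngMultiplet {N : ℕ} (n : ℕ) {Y : YoungDiagram} (t : IndexedTableau N Y) :
    Submodule ℂ (StateSpace n N) :=
  LinearMap.range (colAntisymmetrizer n t ∘ₗ rowSymmetrizer n t)

/-- Invariance of a subspace under `sl(n, ℂ)`, the complexification of `su(n)`. -/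
def IsSlInvariant {n N : ℕ} (W : Submodule ℂ (StateSpace n N)) : Prop :=
  ∀ x : Matrix (Fin n) (Fin n) ℂ, x.trace = 0 → ∀ ψ ∈ W, tensorRep x ψ ∈ W

/-- Two subspaces (the first of them invariant) are equivalent as representations of
`sl(n, ℂ)`: there is a linear bijection that intertwines the actions. -/
def SlEquivalent {n N : ℕ} (W W' : Submodule ℂ (StateSpace n N)) : Prop :=
  ∃ e : W ≃ₗ[ℂ] W', ∀ x : Matrix (Fin n) (Fin n) ℂ, x.trace = 0 →
    ∀ (ψ : W) (h : tensorRep x (ψ : StateSpace n N) ∈ W),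
      (e ⟨tensorRep x (ψ : StateSpace n N), h⟩ : StateSpace n N) = tensorRep x (e ψ)

/-- The `Y` multiplet sector: the subspace formed by (the sum of) all multiplets in the
equivalence class that the Young diagram `Y` characterizes, i.e. all invariant subspaces that are
equivalent to a multiplet constructed from `Y`. -/
def multipletSector (n N : ℕ) (Y : YoungDiagram) : Submodule ℂ (StateSpace n N) :=
  sSup {W | IsSlInvariant W ∧ ∃ t : IndexedTableau N Y, SlEquivalent W (youngMultiplet n t)}

/-- The Young diagram with the row lengths `r 0 ≥ r 1 ≥ ⋯ ≥ r (n - 1)` (rows of length zero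
contribute no boxes). -/
def rowsDiagram {n : ℕ} (r : Fin n → ℕ) (hr : Antitone r) : YoungDiagram :=
  YoungDiagram.ofRowLens (List.ofFn r) (List.sortedGE_ofFn_iff.2 hr)

end SuChain

end

/-!
Write `ε(k)` for the sign `(-1)^(number of inversions)` of a coloring `k` of the sites, where equal
colors do not form inversions. Exchanging two different colors along a bond reverses `ε`
(`inversionSign_comp_bond`); for the bond that closes a ring this is where the parity condition
enters. Hence, in the basis `ε(k) |k⟩` of a weight subspace, the exchange Hamiltonian is a real
symmetric matrix with nonpositive off-diagonal entries, and its bonds connect all basic states. By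
Perron–Frobenius, the relative ground states form a line, spanned by a state `∑ ε(k) a(k) |k⟩` with
all `a(k) > 0` (`IsRelativeGroundState.exists_signed_positive`).

For an indexed tableau `t` of shape `Y` let `c_t` be its Young symmetrizer (rows first, then
columns). The operator `∑_t c_t c_t†` maps into the `Y` multiplet sector, since the image of each
`c_t` is one of the multiplets that define the sector, so neither irreducibility nor an explicit
isotypic decomposition is needed. This operator commutes with all site permutations, hence with the
Hamiltonian, so it multiplies the ground state `Ω` by a scalar, and it remains to see that the
scalar is not zero. It equals `∑_t ‖c_t† Ω‖² / ‖Ω‖²`, so one tableau with `c_t† Ω ≠ 0` suffices.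
Number the boxes of `Y` column by column, and let `k` color each box by the color of its row. Row
permutations fix `k`, and column permutations `τ` satisfy `ε(k ∘ τ) = sign(τ) ε(k)`, as sites
of equal color lie in different columns and keep their order. Therefore all terms of the coefficient
of `c_t† Ω` at `|k⟩` have the same sign.

The Hamiltonian with the matrices `X^a` differs from the exchange Hamiltonian by a real scalar,
by the completeness relation of the `X^a` (`IsSuBasis.exists_suHamiltonian_eq`).
-/

namespace SuChain

open Matrix Finset

/-! ### Inversion signs of colorings -/

/-- The sign `(-1)^(number of inversions)` of a coloring, where an inversion is a pair of sites
`i < j` whose colors satisfy `k j < k i`; pairs of equal colors do not count. -/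
def inversionSign {n N : ℕ} (k : Fin N → Fin n) : ℤ :=
  ∏ i, ∏ j ∈ Ioi i, if k j < k i then -1 else 1

theorem inversionSign_mul_self {n N : ℕ} (k : Fin N → Fin n) :
    inversionSign k * inversionSign k = 1 := by
  simp only [inversionSign, ← prod_mul_distrib]
  exact prod_eq_one fun i _ => prod_eq_one fun j _ => by split_ifs <;> rfl

/-- A site permutation multiplies the inversion sign by its own signature, corrected by the
inversions of the permutation that only involve sites of equal color. -/
theorem inversionSign_comp {n N : ℕ} (k : Fin N → Fin n) (τ : Equiv.Perm (Fin N)) :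
    inversionSign (k ∘ τ) = (Equiv.Perm.sign τ : ℤ) * inversionSign k *
      ∏ i, ∏ j ∈ Ioi i, if k (τ i) = k (τ j) ∧ τ j < τ i then -1 else 1 := by
  -- `f` agrees with the factors of the inversion sign on pairs `i < j` and is antisymmetric.
  let f : Fin N → Fin N → ℤ := fun i j =>
    if k i = k j then (if i < j then 1 else if j < i then -1 else 0)
    else if k j < k i then -1 else 1
  have hf : ∀ i j, f i j = -f j i := by
    intro i j
    simp only [f]
    rcases lt_trichotomy i j with h | h | h <;>
      rcases lt_trichotomy (k i) (k j) with h' | h' | h' <;>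
      first
        | (subst h; simp)
        | simp [h', h'.not_gt, h'.ne, h'.ne']
        | simp [h, h', h.not_gt]
  have h1 : inversionSign k = ∏ i, ∏ j ∈ Ioi i, f i j := by
    refine prod_congr rfl fun i _ => prod_congr rfl fun j hj => ?_
    have hij : i < j := mem_Ioi.1 hj
    by_cases h : k i = k j <;> simp [f, h, hij]
  have h2 := τ.prod_Ioi_comp_eq_sign_mul_prod hf
  simp only [Int.cast_id] at h2
  rw [h1, ← h2, ← prod_mul_distrib]
  refine prod_congr rfl fun i _ => ?_
  rw [← prod_mul_distrib]
  refine prod_congr rfl fun j hj => ?_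
  have hij : τ i ≠ τ j := fun h => (mem_Ioi.1 hj).ne (τ.injective h)
  by_cases h : k (τ i) = k (τ j)
  · rcases lt_or_gt_of_ne hij with h' | h' <;> simp [f, h, h', h'.not_gt]
  · simp [f, h]

theorem inversionSign_comp_of_monotone {n N : ℕ} (k : Fin N → Fin n) (τ : Equiv.Perm (Fin N))
    (h : ∀ i j, i < j → k (τ i) = k (τ j) → τ i < τ j) :
    inversionSign (k ∘ τ) = (Equiv.Perm.sign τ : ℤ) * inversionSign k := by
  rw [inversionSign_comp, prod_eq_one, mul_one]
  refine fun i _ => prod_eq_one fun j hj => if_neg fun h' => ?_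
  exact (h i j (mem_Ioi.1 hj) h'.1).not_gt h'.2

/-- Exchanging two neighboring sites of different colors reverses the inversion sign. -/
theorem inversionSign_comp_swap_of_adjacent {n N : ℕ} (k : Fin N → Fin n) {u v : Fin N}
    (huv : (v : ℕ) = u + 1) (hk : k u ≠ k v) :
    inversionSign (k ∘ Equiv.swap u v) = -inversionSign k := by
  have hne : u ≠ v := by rintro rfl; exact hk rfl
  rw [inversionSign_comp_of_monotone, Equiv.Perm.sign_swap hne]
  · simp
  · intro i j hij hc
    by_contra hlt
    have : i = u ∧ j = v := by
      simp only [Equiv.swap_apply_def] at hlt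
      split_ifs at hlt <;> simp only [Fin.ext_iff, Fin.lt_def] at * <;> omega
    obtain ⟨rfl, rfl⟩ := this
    simp only [Equiv.swap_apply_left, Equiv.swap_apply_right] at hc
    exact hk hc.symm

/-- Exchanging the two end sites, if their colors are different and occur with the same parity,
reverses the inversion sign: the sites in between contribute an even number of inversions. -/
theorem inversionSign_comp_swap_ends {n N : ℕ} (k : Fin (N + 1) → Fin n)
    (hk : k 0 ≠ k (Fin.last N))
    (hpar : (univ.filter fun l => k l = k 0).card ≡
      (univ.filter fun l => k l = k (Fin.last N)).card [MOD 2]) :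
    inversionSign (k ∘ Equiv.swap (Fin.last N) 0) = -inversionSign k := by
  have hne : Fin.last N ≠ 0 := by intro h; rw [h] at hk; exact hk rfl
  set τ := Equiv.swap (Fin.last N) 0 with hτ
  have hprod : ∀ (c : Fin n) (a : Fin (N + 1)), k a = c →
      ∏ x ∈ univ.erase a, (if c = k x then (-1 : ℤ) else 1)
        = -(-1) ^ (univ.filter fun l => k l = c).card := by
    intro c a ha
    have h1 := mul_prod_erase univ (fun x => if c = k x then (-1 : ℤ) else 1) (mem_univ a)
    have h2 : ∏ x, (if c = k x then (-1 : ℤ) else 1) =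
        (-1) ^ (univ.filter fun l => k l = c).card := by
      rw [prod_ite, prod_const_one, mul_one, prod_const]
      simp only [eq_comm]
    rw [h2, if_pos ha.symm] at h1
    linarith
  rw [inversionSign_comp, Equiv.Perm.sign_swap hne]
  -- The inversions of `τ` are the pairs that contain an end site; those with equal colors join the
  -- color moved to that end with an inner site of the same color.
  have hzero : ∏ j ∈ Ioi (0 : Fin (N + 1)),
      (if k (τ 0) = k (τ j) ∧ τ j < τ 0 then (-1 : ℤ) else 1)
        = -(-1) ^ (univ.filter fun l => k l = k (Fin.last N)).card := by
    rw [← hprod _ _ rfl]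
    refine prod_bij (fun j _ => τ j) ?_ (fun _ _ _ _ h => τ.injective h) ?_ ?_
    · intro j hj
      simp only [mem_erase, mem_univ, and_true]
      intro h
      have : τ j = τ 0 := by rw [h, hτ, Equiv.swap_apply_right]
      exact (mem_Ioi.1 hj).ne' (τ.injective this)
    · intro b hb
      refine ⟨τ b, ?_, by simp [hτ]⟩
      rw [mem_Ioi, Fin.pos_iff_ne_zero]
      intro h
      have : b = Fin.last N := by
        rw [← Equiv.swap_apply_right (Fin.last N) 0, ← hτ, ← h, hτ, Equiv.swap_apply_self]
      exact (mem_erase.1 hb).1 this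
    · intro j hj
      have h0 : τ 0 = Fin.last N := Equiv.swap_apply_right _ _
      have hlt : τ j < τ 0 := by
        rw [h0]
        refine lt_of_le_of_ne (Fin.le_last _) fun h => ?_
        exact (mem_Ioi.1 hj).ne' (τ.injective (h.trans h0.symm))
      rw [h0] at hlt ⊢
      simp only [hlt, and_true]
  have hpos : ∀ i ∈ univ.erase (0 : Fin (N + 1)),
      ∏ j ∈ Ioi i, (if k (τ i) = k (τ j) ∧ τ j < τ i then (-1 : ℤ) else 1)
        = if k 0 = k i then -1 else 1 := by
    intro i hi
    have hi0 : i ≠ 0 := (mem_erase.1 hi).1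
    rcases eq_or_ne i (Fin.last N) with rfl | hil
    · rw [if_neg hk]
      refine prod_eq_one fun j hj => ?_
      exact absurd (mem_Ioi.1 hj) (Fin.le_last j).not_gt
    · have hti : τ i = i := Equiv.swap_apply_of_ne_of_ne hil hi0
      rw [prod_eq_single_of_mem (Fin.last N) (mem_Ioi.2 (lt_of_le_of_ne (Fin.le_last i) hil))]
      · rw [hti, hτ, Equiv.swap_apply_left]
        simp [Fin.pos_iff_ne_zero.2 hi0, eq_comm]
      · intro j hj hjl
        have hij := mem_Ioi.1 hj
        have hj0 : j ≠ 0 := ((Fin.zero_le i).trans_lt hij).ne'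
        rw [hti, hτ, Equiv.swap_apply_of_ne_of_ne hjl hj0, if_neg fun h => h.2.not_gt hij]
  rw [← mul_prod_erase univ _ (mem_univ (0 : Fin (N + 1))), hzero, prod_congr rfl hpos,
    hprod _ _ rfl, neg_mul_neg, ← pow_add]
  have heven : Even ((univ.filter fun l => k l = k (Fin.last N)).card +
      (univ.filter fun l => k l = k 0).card) := by
    rw [Nat.even_iff]
    have := hpar
    unfold Nat.ModEq at this
    omega
  rw [heven.neg_one_pow]
  simp

/-- Under the parity condition, every bond that joins two different colors reverses the
inversion sign when its colors are exchanged. -/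
theorem inversionSign_comp_bond {n N : ℕ} {b : Boundary} {m : Fin n → ℕ}
    (hparity : b = Boundary.periodic → ∀ i j, 0 < m i → 0 < m j → m i ≡ m j [MOD 2])
    (k : Fin N → Fin n) (hm : ∀ i, (univ.filter fun l => k l = i).card = m i)
    (l : Fin (numBonds b N)) (hk : k (leftSite l) ≠ k (rightSite l)) :
    inversionSign (k ∘ Equiv.swap (leftSite l) (rightSite l)) = -inversionSign k := by
  rcases lt_or_ge ((l : ℕ) + 1) N with h | h
  · exact inversionSign_comp_swap_of_adjacent k (Nat.mod_eq_of_lt h) hk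
  · have hlN : (l : ℕ) < N := (leftSite l).2
    obtain ⟨M, rfl⟩ : ∃ M, N = M + 1 := ⟨N - 1, by omega⟩
    have hl : (l : ℕ) = M := by omega
    have hleft : leftSite l = Fin.last M := Fin.ext hl
    have hright : rightSite l = 0 := Fin.ext (by simp [rightSite, hl])
    have hb : b = Boundary.periodic := by
      cases b
      · have h' : (l : ℕ) < M := l.2
        omega
      · rfl
    rw [hleft, hright] at hk ⊢
    have hmpos : ∀ a, 0 < m (k a) := fun a => by
      rw [← hm]
      exact card_pos.2 ⟨a, by simp⟩
    refine inversionSign_comp_swap_ends k hk.symm ?_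
    rw [hm, hm]
    exact hparity hb _ _ (hmpos _) (hmpos _)

/-- Two colorings with the same color multiplicities differ by a permutation of the sites. -/
theorem exists_perm_comp_eq {n N : ℕ} {k k' : Fin N → Fin n}
    (h : ∀ i, (univ.filter fun l => k l = i).card = (univ.filter fun l => k' l = i).card) :
    ∃ σ : Equiv.Perm (Fin N), k' = k ∘ σ := by
  have e : ∀ i, Nonempty ({l // k' l = i} ≃ {l // k l = i}) := fun i => by
    rw [← Fintype.card_eq, Fintype.card_subtype, Fintype.card_subtype, h]
  exact ⟨Equiv.ofFiberEquiv fun i => (e i).some,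
    funext fun l => (Equiv.ofFiberEquiv_map (fun i => (e i).some) l).symm⟩

theorem card_filter_comp_perm {n N : ℕ} (k : Fin N → Fin n) (σ : Equiv.Perm (Fin N)) (i : Fin n) :
    (univ.filter fun l => (k ∘ σ) l = i).card = (univ.filter fun l => k l = i).card :=
  card_equiv σ fun l => by simp

/-- The exchanges along the bonds generate all permutations of the sites. -/
theorem closure_bond_swaps (b : Boundary) (N : ℕ) :
    Submonoid.closure (Set.range fun l : Fin (numBonds b N) =>
      Equiv.swap (leftSite l) (rightSite l)) = ⊤ := by
  cases N with
  | zero => exact Subsingleton.elim _ _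
  | succ M =>
    rw [← top_le_iff, ← Equiv.Perm.mclosure_swap_castSucc_succ, Submonoid.closure_le]
    rintro _ ⟨i, rfl⟩
    have hi : (i : ℕ) < numBonds b (M + 1) := by
      cases b
      · exact i.2
      · exact i.2.trans (Nat.lt_succ_self M)
    refine Submonoid.subset_closure ⟨⟨i, hi⟩, ?_⟩
    have hr : rightSite (⟨i, hi⟩ : Fin (numBonds b (M + 1))) = i.succ :=
      Fin.ext (Nat.mod_eq_of_lt (Nat.succ_lt_succ i.2))
    simp only [hr]
    rfl

/-! ### Perron–Frobenius -/

/-- The entrywise absolute value does not increase the quadratic form of a matrix with nonpositive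
off-diagonal entries, so it preserves the kernel if the form is positive semidefinite. -/
theorem mulVec_abs_eq_zero_of_posSemidef {K : Type*} [Fintype K] {B : Matrix K K ℝ}
    (hB : B.PosSemidef) (hoff : ∀ i j, i ≠ j → B i j ≤ 0)
    {v : K → ℝ} (hv : B *ᵥ v = 0) : B *ᵥ (fun i => |v i|) = 0 := by
  rw [← hB.dotProduct_mulVec_zero_iff]
  refine le_antisymm ?_ (hB.dotProduct_mulVec_nonneg _)
  have h0 : v ⬝ᵥ B *ᵥ v = 0 := by rw [hv, dotProduct_zero]
  rw [← h0]
  simp only [dotProduct, mulVec, mul_sum, star_trivial]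
  refine sum_le_sum fun i _ => sum_le_sum fun j _ => ?_
  rcases eq_or_ne i j with rfl | hij
  · have := abs_mul_abs_self (v i)
    exact le_of_eq (by linear_combination B i i * this)
  · have h1 : v i * v j ≤ |v i| * |v j| := by rw [← abs_mul]; exact le_abs_self _
    nlinarith [hoff i j hij]

/-- If an entry of a kernel vector vanishes, then, by the equation of the kernel at this entry for
the absolute values, so do the entries at all neighboring indices. -/
theorem ne_zero_of_mulVec_eq_zero {K : Type*} [Fintype K] {B : Matrix K K ℝ}
    (hB : B.PosSemidef) (hoff : ∀ i j, i ≠ j → B i j ≤ 0)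
    (hconn : ∀ i j, Relation.ReflTransGen (fun i j => B i j < 0) i j)
    {v : K → ℝ} (hv : B *ᵥ v = 0) (hne : v ≠ 0) (i : K) : v i ≠ 0 := by
  intro hi
  have habs := mulVec_abs_eq_zero_of_posSemidef hB hoff hv
  refine hne (funext fun j => ?_)
  induction hconn i j with
  | refl => exact hi
  | @tail a c _ hac ih =>
    have ha : ∑ j, B a j * |v j| = 0 := congrFun habs a
    have hle : ∀ j ∈ univ, B a j * |v j| ≤ 0 := by
      intro j _
      rcases eq_or_ne a j with rfl | haj
      · rw [ih]; simp
      · exact mul_nonpos_of_nonpos_of_nonneg (hoff a j haj) (abs_nonneg _)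
    have := (sum_eq_zero_iff_of_nonpos hle).1 ha c (mem_univ c)
    simpa [hac.ne] using this

/-- Perron–Frobenius: the complex kernel of a connected real positive semidefinite matrix with
nonpositive off-diagonal entries, if it is not zero, is spanned by a positive vector. -/
theorem exists_pos_spanning_kernel {K : Type*} [Fintype K] {B : Matrix K K ℝ}
    (hB : B.PosSemidef) (hoff : ∀ i j, i ≠ j → B i j ≤ 0)
    (hconn : ∀ i j, Relation.ReflTransGen (fun i j => B i j < 0) i j)
    {φ : K → ℂ} (hφ : ∀ i, ∑ j, (B i j : ℂ) * φ j = 0) (hne : φ ≠ 0) :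
    ∃ a : K → ℝ, (∀ i, 0 < a i) ∧ ∀ ψ : K → ℂ, (∀ i, ∑ j, (B i j : ℂ) * ψ j = 0) →
      ∃ c : ℂ, ∀ i, ψ i = c * a i := by
  have hre : ∀ ψ : K → ℂ, (∀ i, ∑ j, (B i j : ℂ) * ψ j = 0) → B *ᵥ (fun i => (ψ i).re) = 0 :=
    fun ψ h => funext fun i => by simpa [mulVec, dotProduct] using congrArg Complex.re (h i)
  have him : ∀ ψ : K → ℂ, (∀ i, ∑ j, (B i j : ℂ) * ψ j = 0) → B *ᵥ (fun i => (ψ i).im) = 0 :=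
    fun ψ h => funext fun i => by simpa [mulVec, dotProduct] using congrArg Complex.im (h i)
  obtain ⟨v, hv, hv0⟩ : ∃ v : K → ℝ, B *ᵥ v = 0 ∧ v ≠ 0 := by
    by_contra! hcon
    refine hne (funext fun i => Complex.ext ?_ ?_)
    · exact congrFun (hcon _ (hre φ hφ)) i
    · exact congrFun (hcon _ (him φ hφ)) i
  have ha := mulVec_abs_eq_zero_of_posSemidef hB hoff hv
  have hpos : ∀ i, 0 < |v i| := fun i =>
    abs_pos.2 (ne_zero_of_mulVec_eq_zero hB hoff hconn hv hv0 i)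
  refine ⟨fun i => |v i|, hpos, fun ψ hψ => ?_⟩
  obtain ⟨i₀, -⟩ := Function.ne_iff.1 hne
  -- A combination of two kernel vectors that vanishes at `i₀` vanishes everywhere.
  have hprop : ∀ w : K → ℝ, B *ᵥ w = 0 → ∀ i, w i = w i₀ / |v i₀| * |v i| := by
    intro w hw i
    have hz : w - (w i₀ / |v i₀|) • (fun i => |v i|) = 0 := by
      by_contra hcon
      refine ne_zero_of_mulVec_eq_zero hB hoff hconn ?_ hcon i₀ ?_
      · rw [mulVec_sub, mulVec_smul, hw, ha, smul_zero, sub_zero]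
      · simp [div_mul_cancel₀ _ (hpos i₀).ne']
    simpa [sub_eq_zero] using congrFun hz i
  refine ⟨⟨(ψ i₀).re / |v i₀|, (ψ i₀).im / |v i₀|⟩, fun i => Complex.ext ?_ ?_⟩
  · simpa using hprop _ (hre ψ hψ) i
  · simpa using hprop _ (him ψ hψ) i

/-! ### Site permutations and Young symmetrizers -/

theorem permOp_apply {n N : ℕ} (τ : Equiv.Perm (Fin N)) (ψ : StateSpace n N) (k : Fin N → Fin n) :
    permOp τ ψ k = ψ (k ∘ τ) := rfl

theorem permOp_mul {n N : ℕ} (σ τ : Equiv.Perm (Fin N)) :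
    (permOp (σ * τ) : StateSpace n N →ₗ[ℂ] _) = permOp σ ∘ₗ permOp τ := rfl

theorem siteOp_permOp {n N : ℕ} (l : Fin N) (x : Matrix (Fin n) (Fin n) ℂ)
    (τ : Equiv.Perm (Fin N)) (ψ : StateSpace n N) :
    siteOp l x (permOp τ ψ) = permOp τ (siteOp (τ⁻¹ l) x ψ) := by
  obtain ⟨l, rfl⟩ := τ.surjective l
  have hl : τ⁻¹ (τ l) = l := τ.symm_apply_apply l
  rw [hl]
  funext k
  simp only [siteOp, permOp_apply, LinearMap.coe_mk, AddHom.coe_mk, Function.comp_apply]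
  refine sum_congr rfl fun j _ => ?_
  congr 2
  exact Function.update_comp_eq_of_injective k τ.injective l j

theorem tensorRep_permOp {n N : ℕ} (x : Matrix (Fin n) (Fin n) ℂ) (τ : Equiv.Perm (Fin N))
    (ψ : StateSpace n N) : tensorRep x (permOp τ ψ) = permOp τ (tensorRep x ψ) := by
  simp only [tensorRep, LinearMap.sum_apply, siteOp_permOp, map_sum]
  exact Equiv.sum_comp τ⁻¹ fun l => permOp τ (siteOp l x ψ)

theorem mem_weightSpace_iff {n N : ℕ} {m : Fin n → ℕ} {ψ : StateSpace n N} :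
    ψ ∈ weightSpace N m ↔
      ∀ k, (¬ ∀ i, (univ.filter fun l => k l = i).card = m i) → ψ k = 0 := by
  classical
  constructor
  · intro h k hk
    induction h using Submodule.span_induction with
    | mem φ hφ =>
      obtain ⟨k', hk', rfl⟩ := hφ
      refine Pi.single_eq_of_ne ?_ _
      rintro rfl
      exact hk hk'
    | zero => rfl
    | add φ χ _ _ h1 h2 => simp [h1, h2]
    | smul c φ _ h1 => simp [h1]
  · intro h
    have hsum : ψ = ∑ k, ψ k • ket k := by
      funext k
      simp [ket, Finset.sum_apply, Pi.single_apply]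
    rw [hsum]
    refine Submodule.sum_mem _ fun k _ => ?_
    by_cases hk : ∀ i, (univ.filter fun l => k l = i).card = m i
    · exact Submodule.smul_mem _ _ (Submodule.subset_span ⟨k, hk, rfl⟩)
    · rw [h k hk, zero_smul]
      exact Submodule.zero_mem _

theorem permOp_mem_weightSpace {n N : ℕ} {m : Fin n → ℕ} {ψ : StateSpace n N}
    (hψ : ψ ∈ weightSpace N m) (τ : Equiv.Perm (Fin N)) : permOp τ ψ ∈ weightSpace N m := by
  rw [mem_weightSpace_iff] at hψ ⊢
  intro k hk
  rw [permOp_apply]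
  refine hψ _ fun h => hk fun i => ?_
  rw [← h i, card_filter_comp_perm]

/-- The weighted sum, with weights `χ`, of the site permutations that preserve the fibers of `f`.
Row symmetrizers (`f` is the row index and `χ = 1`) and column antisymmetrizers (`f` is the column
index and `χ` the signature) are of this form. -/
noncomputable def fiberSum (n : ℕ) {N : ℕ} (f : Fin N → ℕ) (χ : Equiv.Perm (Fin N) → ℂ) :
    StateSpace n N →ₗ[ℂ] StateSpace n N :=
  ∑ τ : Equiv.Perm (Fin N) with ∀ l, f (τ l) = f l, χ τ • permOp τ

theorem rowSymmetrizer_eq_fiberSum {n N : ℕ} {Y : YoungDiagram} (t : IndexedTableau N Y) :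
    rowSymmetrizer n t = fiberSum n (fun l => (t l).1.1) 1 := by
  simp [rowSymmetrizer, fiberSum]

theorem colAntisymmetrizer_eq_fiberSum {n N : ℕ} {Y : YoungDiagram} (t : IndexedTableau N Y) :
    colAntisymmetrizer n t =
      fiberSum n (fun l => (t l).1.2) fun τ => ((Equiv.Perm.sign τ : ℤ) : ℂ) := rfl

section fiberSum

variable {n N : ℕ} (f : Fin N → ℕ) {χ : Equiv.Perm (Fin N) → ℂ}

theorem fiberSum_apply (ψ : StateSpace n N) (k : Fin N → Fin n) :
    fiberSum n f χ ψ k =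
      ∑ τ : Equiv.Perm (Fin N) with ∀ l, f (τ l) = f l, χ τ * ψ (k ∘ τ) := by
  simp [fiberSum, LinearMap.sum_apply, Finset.sum_apply, permOp_apply]

theorem tensorRep_fiberSum (x : Matrix (Fin n) (Fin n) ℂ) (ψ : StateSpace n N) :
    tensorRep x (fiberSum n f χ ψ) = fiberSum n f χ (tensorRep x ψ) := by
  simp [fiberSum, LinearMap.sum_apply, tensorRep_permOp]

theorem fiberSum_mem_weightSpace {m : Fin n → ℕ} {ψ : StateSpace n N}
    (hψ : ψ ∈ weightSpace N m) : fiberSum n f χ ψ ∈ weightSpace N m := by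
  simp only [fiberSum, LinearMap.sum_apply, LinearMap.smul_apply]
  exact Submodule.sum_mem _ fun τ _ => Submodule.smul_mem _ _ (permOp_mem_weightSpace hψ τ)

theorem permOp_fiberSum (hχ : ∀ σ τ, χ (σ * τ * σ⁻¹) = χ τ) (σ : Equiv.Perm (Fin N))
    (ψ : StateSpace n N) :
    permOp σ (fiberSum n f χ ψ) = fiberSum n (f ∘ ⇑σ⁻¹) χ (permOp σ ψ) := by
  simp only [fiberSum, LinearMap.sum_apply, map_sum, LinearMap.smul_apply, map_smul]
  refine sum_equiv (MulAut.conj σ).toEquiv (fun τ => ?_) fun τ _ => ?_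
  · simp only [mem_filter, mem_univ, true_and, MulEquiv.toEquiv_eq_coe, EquivLike.coe_coe,
      MulAut.conj_apply, Equiv.Perm.mul_apply, Function.comp_apply]
    exact ⟨fun h l => by simpa using h (σ⁻¹ l), fun h l => by simpa using h (σ l)⟩
  · simp only [MulEquiv.toEquiv_eq_coe, EquivLike.coe_coe, MulAut.conj_apply, hχ]
    rw [← LinearMap.comp_apply, ← permOp_mul, ← LinearMap.comp_apply, ← permOp_mul,
      inv_mul_cancel_right]

theorem star_dotProduct_permOp (σ : Equiv.Perm (Fin N)) (φ ψ : StateSpace n N) :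
    star φ ⬝ᵥ permOp σ ψ = star (permOp σ⁻¹ φ) ⬝ᵥ ψ := by
  refine sum_equiv (Equiv.arrowCongr σ.symm (Equiv.refl _)) (by simp) fun k _ => ?_
  have h : (k ∘ σ) ∘ ⇑σ⁻¹ = k := funext fun l => by simp
  change star (φ k) * ψ (k ∘ σ) = star (φ ((k ∘ σ) ∘ ⇑σ⁻¹)) * ψ (k ∘ σ)
  rw [h]

/-- Symmetrizers and antisymmetrizers are self-adjoint. -/
theorem star_dotProduct_fiberSum (hχ : ∀ τ, star (χ τ) = χ τ⁻¹) (φ ψ : StateSpace n N) :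
    star φ ⬝ᵥ fiberSum n f χ ψ = star (fiberSum n f χ φ) ⬝ᵥ ψ := by
  simp only [fiberSum, LinearMap.sum_apply, dotProduct_sum, LinearMap.smul_apply, dotProduct_smul,
    star_sum, sum_dotProduct, star_smul, smul_dotProduct, star_dotProduct_permOp]
  refine sum_equiv (Equiv.inv _) (fun τ => ?_) fun τ _ => ?_
  · simp only [mem_filter, mem_univ, true_and, Equiv.inv_apply]
    exact ⟨fun h l => by simpa using (h (τ⁻¹ l)).symm, fun h l => by simpa using (h (τ l)).symm⟩
  · rw [Equiv.inv_apply, hχ, inv_inv]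

end fiberSum

theorem youngMultiplet_le_multipletSector {n N : ℕ} {Y : YoungDiagram} (t : IndexedTableau N Y) :
    youngMultiplet n t ≤ multipletSector n N Y := by
  refine le_sSup ⟨?_, t, LinearEquiv.refl ℂ _, fun x _ ψ _ => rfl⟩
  rintro x - _ ⟨ψ, rfl⟩
  refine ⟨tensorRep x ψ, ?_⟩
  simp only [LinearMap.comp_apply, rowSymmetrizer_eq_fiberSum, colAntisymmetrizer_eq_fiberSum,
    tensorRep_fiberSum]

/-- The operator `∑_t c_t c_t†` over all indexed tableaux `t` of shape `Y`, where `c_t` is the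
Young symmetrizer of `t`. It maps into the `Y` multiplet sector, and it commutes with all site
permutations. -/
noncomputable def tableauSum (n N : ℕ) (Y : YoungDiagram) : StateSpace n N →ₗ[ℂ] StateSpace n N :=
  ∑ t : IndexedTableau N Y, (colAntisymmetrizer n t ∘ₗ rowSymmetrizer n t) ∘ₗ
    (rowSymmetrizer n t ∘ₗ colAntisymmetrizer n t)

theorem tableauSum_mem_multipletSector {n N : ℕ} (Y : YoungDiagram) (ψ : StateSpace n N) :
    tableauSum n N Y ψ ∈ multipletSector n N Y := by
  rw [tableauSum, LinearMap.sum_apply]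
  exact Submodule.sum_mem _ fun t _ =>
    youngMultiplet_le_multipletSector t (LinearMap.mem_range_self _ _)

theorem tableauSum_mem_weightSpace {n N : ℕ} (Y : YoungDiagram) {m : Fin n → ℕ}
    {ψ : StateSpace n N} (hψ : ψ ∈ weightSpace N m) : tableauSum n N Y ψ ∈ weightSpace N m := by
  simp only [tableauSum, LinearMap.sum_apply, LinearMap.comp_apply, rowSymmetrizer_eq_fiberSum,
    colAntisymmetrizer_eq_fiberSum]
  exact Submodule.sum_mem _ fun t _ => fiberSum_mem_weightSpace _ (fiberSum_mem_weightSpace _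
    (fiberSum_mem_weightSpace _ (fiberSum_mem_weightSpace _ hψ)))

theorem permOp_tableauSum {n N : ℕ} (Y : YoungDiagram) (σ : Equiv.Perm (Fin N))
    (ψ : StateSpace n N) :
    permOp σ (tableauSum n N Y ψ) = tableauSum n N Y (permOp σ ψ) := by
  have h1 : ∀ σ τ : Equiv.Perm (Fin N), (1 : Equiv.Perm (Fin N) → ℂ) (σ * τ * σ⁻¹) =
      (1 : Equiv.Perm (Fin N) → ℂ) τ := fun _ _ => rfl
  have hs : ∀ σ τ : Equiv.Perm (Fin N), ((Equiv.Perm.sign (σ * τ * σ⁻¹) : ℤ) : ℂ) =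
      ((Equiv.Perm.sign τ : ℤ) : ℂ) := fun σ τ => by
    rw [map_mul, map_mul, map_inv, mul_right_comm, mul_inv_cancel, one_mul]
  simp only [tableauSum, LinearMap.sum_apply, LinearMap.comp_apply, map_sum]
  refine Fintype.sum_equiv (Equiv.equivCongr σ (Equiv.refl Y.cells)) _ _ fun t => ?_
  simp only [rowSymmetrizer_eq_fiberSum, colAntisymmetrizer_eq_fiberSum]
  rw [permOp_fiberSum _ hs, permOp_fiberSum _ h1, permOp_fiberSum _ h1, permOp_fiberSum _ hs]
  rfl

theorem exchangeHamiltonian_tableauSum {n N : ℕ} {b : Boundary} (J : Fin (numBonds b N) → ℝ)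
    (Y : YoungDiagram) (ψ : StateSpace n N) :
    exchangeHamiltonian n J (tableauSum n N Y ψ) =
      tableauSum n N Y (exchangeHamiltonian n J ψ) := by
  simp only [exchangeHamiltonian, LinearMap.sum_apply, LinearMap.smul_apply, permOp_tableauSum,
    map_sum, map_smul]

open scoped ComplexOrder in
/-- The operator `∑_t c_t c_t†` has a nonzero (in fact positive) expectation value in each state
that is not killed by all the `c_t†`. -/
theorem star_dotProduct_tableauSum_ne_zero {n N : ℕ} {Y : YoungDiagram} {ψ : StateSpace n N}
    (t : IndexedTableau N Y) (ht : rowSymmetrizer n t (colAntisymmetrizer n t ψ) ≠ 0) :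
    star ψ ⬝ᵥ tableauSum n N Y ψ ≠ 0 := by
  have h1 : ∀ τ : Equiv.Perm (Fin N), star ((1 : Equiv.Perm (Fin N) → ℂ) τ) =
      (1 : Equiv.Perm (Fin N) → ℂ) τ⁻¹ := fun _ => star_one _
  have hs : ∀ τ : Equiv.Perm (Fin N), star ((Equiv.Perm.sign τ : ℤ) : ℂ) =
      ((Equiv.Perm.sign τ⁻¹ : ℤ) : ℂ) := fun τ => by simp
  have h : ∀ t' : IndexedTableau N Y,
      star ψ ⬝ᵥ colAntisymmetrizer n t' (rowSymmetrizer n t' (rowSymmetrizer n t'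
        (colAntisymmetrizer n t' ψ))) = star (rowSymmetrizer n t' (colAntisymmetrizer n t' ψ)) ⬝ᵥ
          rowSymmetrizer n t' (colAntisymmetrizer n t' ψ) := by
    intro t'
    rw [colAntisymmetrizer_eq_fiberSum, rowSymmetrizer_eq_fiberSum,
      star_dotProduct_fiberSum _ hs, star_dotProduct_fiberSum _ h1]
  rw [tableauSum, LinearMap.sum_apply, dotProduct_sum]
  refine (sum_pos' (fun t' _ => (dotProduct_star_self_nonneg _).trans_eq (h t').symm)
    ⟨t, mem_univ _, (dotProduct_star_self_pos_iff.2 ht).trans_eq (h t).symm⟩).ne'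

/-! ### Tableaux in column reading order -/

theorem mem_rowsDiagram {n : ℕ} {r : Fin n → ℕ} {hr : Antitone r} {c : ℕ × ℕ} :
    c ∈ (rowsDiagram r hr).cells ↔ ∃ h : c.1 < n, c.2 < r ⟨c.1, h⟩ := by
  rw [YoungDiagram.mem_cells, rowsDiagram, YoungDiagram.mem_ofRowLens]
  simp

theorem card_filter_row_rowsDiagram {n : ℕ} (r : Fin n → ℕ) (hr : Antitone r) (i : Fin n) :
    ((rowsDiagram r hr).cells.filter fun c => c.1 = (i : ℕ)).card = r i := by
  have : (rowsDiagram r hr).cells.filter (fun c => c.1 = (i : ℕ)) =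
      (range (r i)).map ⟨fun j => ((i : ℕ), j), fun _ _ h => (Prod.mk.inj h).2⟩ := by
    ext ⟨a, c⟩
    simp only [mem_filter, mem_rowsDiagram, mem_map, mem_range]
    constructor
    · rintro ⟨⟨h, hc⟩, rfl⟩
      exact ⟨c, hc, rfl⟩
    · rintro ⟨c', hc', h⟩
      obtain ⟨rfl, rfl⟩ := Prod.mk.inj h
      exact ⟨⟨i.2, hc'⟩, rfl⟩
  rw [this, card_map, card_range]

theorem card_rowsDiagram {n : ℕ} (r : Fin n → ℕ) (hr : Antitone r) :
    (rowsDiagram r hr).cells.card = ∑ i, r i := by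
  rw [card_eq_sum_card_fiberwise (f := Prod.fst) (t := range n)]
  · rw [sum_range]
    exact sum_congr rfl fun i _ => card_filter_row_rowsDiagram r hr i
  · intro c hc
    obtain ⟨h, -⟩ := mem_rowsDiagram.1 (mem_coe.1 hc)
    simpa using h

/-- The boxes of a Young diagram, read column by column from the left and from top to bottom in
each column. -/
theorem exists_columnReading {N : ℕ} (Y : YoungDiagram) (hY : Y.cells.card = N) :
    ∃ t : IndexedTableau N Y, ∀ i j, i < j →
      (t i).1.2 < (t j).1.2 ∨ (t i).1.2 = (t j).1.2 ∧ (t i).1.1 < (t j).1.1 := by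
  let e : ℕ × ℕ ≃ ℕ ×ₗ ℕ := (Equiv.prodComm ℕ ℕ).trans toLex
  let S : Finset (ℕ ×ₗ ℕ) := Y.cells.map e.toEmbedding
  have hS : S.card = N := by rw [card_map, hY]
  let s : Y.cells ≃ S := e.subtypeEquiv fun c => by simp [S]
  refine ⟨(S.orderIsoOfFin hS).toEquiv.trans s.symm, fun i j hij => ?_⟩
  have h : S.orderIsoOfFin hS i < S.orderIsoOfFin hS j := (S.orderIsoOfFin hS).lt_iff_lt.2 hij
  have hs : ∀ x : S, x.1 = toLex ((s.symm x).1.2, (s.symm x).1.1) := fun x => by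
    conv_lhs => rw [← s.apply_symm_apply x]
    rfl
  rw [← Subtype.coe_lt_coe, hs, hs, Prod.Lex.toLex_lt_toLex] at h
  exact h

/-- Coloring each box of the diagram by the color of its row, in the column reading order of
the sites: the coloring has the given multiplicities, it is constant on the rows, and permutations
of the sites in the columns multiply its inversion sign by their signature. -/
theorem exists_tableau_and_coloring {n N : ℕ} {m : Fin n → ℕ} (hm : ∑ i, m i = N)
    (p : Equiv.Perm (Fin n)) (hp : Antitone (m ∘ p)) :
    ∃ (t : IndexedTableau N (rowsDiagram (m ∘ p) hp)) (k : Fin N → Fin n),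
      (∀ i, (univ.filter fun l => k l = i).card = m i) ∧
      (∀ τ : Equiv.Perm (Fin N), (∀ l, (t (τ l)).1.1 = (t l).1.1) → k ∘ τ = k) ∧
      (∀ τ : Equiv.Perm (Fin N), (∀ l, (t (τ l)).1.2 = (t l).1.2) →
        inversionSign (k ∘ τ) = (Equiv.Perm.sign τ : ℤ) * inversionSign k) := by
  have hcard : (rowsDiagram (m ∘ p) hp).cells.card = N := by
    rw [card_rowsDiagram, ← hm]
    exact Equiv.sum_comp p m
  obtain ⟨t, ht⟩ := exists_columnReading _ hcard
  have hlt : ∀ l, (t l).1.1 < n := fun l => (mem_rowsDiagram.1 (t l).2).1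
  refine ⟨t, fun l => p ⟨(t l).1.1, hlt l⟩, fun i => ?_, fun τ hτ => ?_, fun τ hτ => ?_⟩
  · obtain ⟨i, rfl⟩ := p.surjective i
    rw [← Function.comp_apply (f := m) (g := p), ← card_filter_row_rowsDiagram (m ∘ p) hp i]
    refine card_bij (fun l _ => (t l).1) (fun l hl => ?_)
      (fun l _ l' _ h => t.injective (Subtype.ext h)) (fun c hc => ?_)
    · simp only [mem_filter, mem_univ, true_and, EmbeddingLike.apply_eq_iff_eq] at hl
      exact mem_filter.2 ⟨(t l).2, congrArg Fin.val hl⟩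
    · obtain ⟨hc, hi⟩ := mem_filter.1 hc
      refine ⟨t.symm ⟨c, hc⟩, ?_, by simp⟩
      simp [hi]
  · funext l
    simp [hτ l]
  · refine inversionSign_comp_of_monotone _ τ fun i j hij hc => ?_
    have hrow : (t (τ i)).1.1 = (t (τ j)).1.1 := congrArg Fin.val (p.injective hc)
    have hcol : (t i).1.2 < (t j).1.2 := by
      rcases ht i j hij with h | ⟨h, -⟩
      · exact h
      · have : t (τ i) = t (τ j) := Subtype.ext (Prod.ext hrow (by rw [hτ, hτ, h]))
        exact absurd (τ.injective (t.injective this)) hij.ne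
    by_contra hlt'
    -- Otherwise `τ j` is read before `τ i`, against the order of the columns, which `τ` preserves.
    rcases (not_lt.1 hlt').lt_or_eq with h | h
    · rcases ht _ _ h with h' | ⟨h', -⟩ <;> rw [hτ, hτ] at h' <;> omega
    · exact hij.ne' (τ.injective h)

/-! ### The two forms of the Hamiltonian -/

/-- The completeness relation of an orthonormal basis of `su(n)`:
`∑_a X^a ⊗ X^a` is the exchange operator minus `1/n`. -/
theorem IsSuBasis.completeness {n : ℕ} {X : Fin (n ^ 2 - 1) → Matrix (Fin n) (Fin n) ℂ}
    (hX : IsSuBasis X) (i j k l : Fin n) :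
    ∑ a, X a i j * X a k l =
      (if i = l ∧ j = k then 1 else 0) - (if i = j ∧ k = l then 1 else 0) / (n : ℂ) := by
  have hn : 0 < n := i.pos
  have hn' : (n : ℂ) ≠ 0 := Nat.cast_ne_zero.2 hn.ne'
  -- The matrices `X^a` and `1` are orthogonal for the trace form and there are `n²` of them, so the
  -- matrix `U` of their entries has the transposed entries as a right inverse.
  let U : Matrix (Fin n × Fin n) (Option (Fin (n ^ 2 - 1))) ℂ :=
    fun q o => o.elim (if q.1 = q.2 then 1 else 0) fun a => X a q.1 q.2
  let V : Matrix (Option (Fin (n ^ 2 - 1))) (Fin n × Fin n) ℂ :=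
    fun o q => o.elim (if q.1 = q.2 then (n : ℂ)⁻¹ else 0) fun a => X a q.2 q.1
  have hcard : Fintype.card (Option (Fin (n ^ 2 - 1))) = Fintype.card (Fin n × Fin n) := by
    have : 0 < n ^ 2 := pow_pos hn 2
    simp only [Fintype.card_option, Fintype.card_fin, Fintype.card_prod]
    rw [← sq]
    omega
  have hVU : V * U = 1 := by
    ext o o'
    rw [mul_apply, Fintype.sum_prod_type]
    rcases o with _ | a <;> rcases o' with _ | a'
    · simp [U, V, hn']
    · have := hX.trace_eq_zero a'
      simp only [trace, diag_apply] at this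
      simp [U, V, ← mul_sum, this]
    · have := hX.trace_eq_zero a
      simp only [trace, diag_apply] at this
      simp [U, V, this]
    · have := hX.trace_mul a a'
      simp only [trace, diag_apply, mul_apply] at this
      rw [sum_comm] at this
      simp [U, V, this, one_apply]
  have hUV := (mul_eq_one_comm_of_card_eq (R := ℂ) _ _ hcard).1 hVU
  have h := congrFun (congrFun hUV (i, j)) (l, k)
  rw [mul_apply, Fintype.sum_option] at h
  simp only [U, V, Option.elim, one_apply, Prod.mk.injEq] at h
  rw [← h]
  by_cases h1 : i = j <;> by_cases h2 : k = l <;> simp [h1, h2, Ne.symm]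

theorem siteOp_comp_siteOp_apply {n N : ℕ} (l r : Fin N) (x y : Matrix (Fin n) (Fin n) ℂ)
    (ψ : StateSpace n N) (k : Fin N → Fin n) :
    (siteOp l x ∘ₗ siteOp r y) ψ k = ∑ j, ∑ j', x (k l) j *
      y (Function.update k l j r) j' * ψ (Function.update (Function.update k l j) r j') := by
  simp only [siteOp, LinearMap.comp_apply, LinearMap.coe_mk, AddHom.coe_mk, mul_sum, mul_assoc]

/-- On each bond, the two forms of the Hamiltonian differ by a real scalar. The bond of a one-site
ring joins the site to itself, where `∑_a (X^a)²` is a scalar by itself. -/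
theorem IsSuBasis.exists_bond_eq {n N : ℕ} {X : Fin (n ^ 2 - 1) → Matrix (Fin n) (Fin n) ℂ}
    (hX : IsSuBasis X) (l r : Fin N) :
    ∃ c : ℝ, ∑ a, (siteOp l (X a) ∘ₗ siteOp r (X a)) =
      permOp (Equiv.swap l r) + (c : ℂ) • (LinearMap.id : StateSpace n N →ₗ[ℂ] _) := by
  have hsum : ∀ (ψ : StateSpace n N) (k : Fin N → Fin n),
      (∑ a, (siteOp l (X a) ∘ₗ siteOp r (X a))) ψ k = ∑ j, ∑ j',
        (∑ a, X a (k l) j * X a (Function.update k l j r) j') *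
          ψ (Function.update (Function.update k l j) r j') := by
    intro ψ k
    simp only [LinearMap.sum_apply, Finset.sum_apply, siteOp_comp_siteOp_apply]
    rw [sum_comm]
    refine sum_congr rfl fun j _ => ?_
    rw [sum_comm]
    exact sum_congr rfl fun j' _ => by rw [sum_mul]
  rcases eq_or_ne l r with rfl | hlr
  · refine ⟨n - (n : ℝ)⁻¹ - 1, LinearMap.ext fun ψ => funext fun k => ?_⟩
    rw [hsum]
    simp only [hX.completeness, Function.update_self, Function.update_idem, and_true]
    have h : ∀ j j' : Fin n, ((if k l = j' then 1 else 0) -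
        (if k l = j ∧ j = j' then 1 else 0) / (n : ℂ)) * ψ (Function.update k l j') =
        (if k l = j' then ψ (Function.update k l j') else 0) -
        (if j = j' then if k l = j then (n : ℂ)⁻¹ * ψ (Function.update k l j') else 0 else 0) := by
      intro j j'
      by_cases h1 : k l = j' <;> by_cases h2 : k l = j <;> by_cases h3 : j = j' <;>
        simp_all [sub_mul, div_eq_mul_inv]
    simp only [h, sum_sub_distrib, sum_ite_eq, mem_univ, if_true, Function.update_eq_self]
    have hswap : permOp (Equiv.refl (Fin N)) ψ k = ψ k := by
      simp [permOp, LinearMap.funLeft_apply]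
    simp [hswap, sub_mul]
  · refine ⟨-(n : ℝ)⁻¹, LinearMap.ext fun ψ => funext fun k => ?_⟩
    rw [hsum]
    simp only [hX.completeness, Function.update_of_ne hlr.symm]
    have h : ∀ j j' : Fin n, ((if k l = j' ∧ j = k r then 1 else 0) -
        (if k l = j ∧ k r = j' then 1 else 0) / (n : ℂ)) *
          ψ (Function.update (Function.update k l j) r j') =
        (if k l = j' then if k r = j then
          ψ (Function.update (Function.update k l j) r j') else 0 else 0) -
        (if k r = j' then if k l = j then
          (n : ℂ)⁻¹ * ψ (Function.update (Function.update k l j) r j') else 0 else 0) := by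
      intro j j'
      simp only [eq_comm (a := j) (b := k r), and_comm (a := k l = j), ite_and, sub_mul,
        ite_mul, ite_div, zero_mul, one_mul, zero_div, one_div]
    simp only [h, sum_sub_distrib, sum_ite_eq, mem_univ, if_true]
    have hswap : Function.update (Function.update k l (k r)) r (k l) = k ∘ Equiv.swap l r := by
      funext x
      rcases eq_or_ne x r with rfl | hxr
      · simp
      rcases eq_or_ne x l with rfl | hxl
      · simp [hxr]
      · simp [hxr, hxl, Equiv.swap_apply_of_ne_of_ne hxl hxr]
    have hid : Function.update (Function.update k l (k l)) r (k r) = k := by simp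
    rw [hswap, hid]
    simp [permOp, LinearMap.funLeft_apply, sub_eq_add_neg]

theorem IsSuBasis.exists_suHamiltonian_eq {n N : ℕ} {b : Boundary}
    {X : Fin (n ^ 2 - 1) → Matrix (Fin n) (Fin n) ℂ} (hX : IsSuBasis X)
    (J : Fin (numBonds b N) → ℝ) :
    ∃ c : ℝ, suHamiltonian X J = exchangeHamiltonian n J + (c : ℂ) • LinearMap.id := by
  choose c hc using fun l : Fin (numBonds b N) => hX.exists_bond_eq (leftSite l) (rightSite l)
  refine ⟨∑ l, J l * c l, ?_⟩
  simp only [suHamiltonian, exchangeHamiltonian, ← smul_sum, hc, smul_add, sum_add_distrib,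
    smul_smul, ← sum_smul]
  push_cast
  rfl

theorem IsRelativeGroundState.of_add_smul_id {n N : ℕ} {H : StateSpace n N →ₗ[ℂ] StateSpace n N}
    {c : ℝ} {m : Fin n → ℕ} {Ω : StateSpace n N}
    (h : IsRelativeGroundState (H + (c : ℂ) • LinearMap.id) m Ω) :
    IsRelativeGroundState H m Ω := by
  obtain ⟨E, hΩ, h0, hE, hmin⟩ := h
  refine ⟨E - c, hΩ, h0, ?_, fun E' ψ hψ hψ0 hE' => ?_⟩
  · simp only [LinearMap.add_apply, LinearMap.smul_apply, LinearMap.id_apply] at hE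
    rw [Complex.ofReal_sub, sub_smul, ← hE, add_sub_cancel_right]
  · have := hmin (E' + c) ψ hψ hψ0 (by simp [hE', add_smul])
    linarith

/-! ### Relative ground states -/

theorem exchangeHamiltonian_apply {n N : ℕ} {b : Boundary} (J : Fin (numBonds b N) → ℝ)
    (ψ : StateSpace n N) (k : Fin N → Fin n) :
    exchangeHamiltonian n J ψ k =
      ∑ l, (J l : ℂ) * ψ (k ∘ Equiv.swap (leftSite l) (rightSite l)) := by
  simp [exchangeHamiltonian, LinearMap.sum_apply, Finset.sum_apply, permOp_apply]

/-- The colorings of the sites with the color multiplicities `m`: they label the basic states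
in the weight subspace. -/
abbrev Coloring {n : ℕ} (N : ℕ) (m : Fin n → ℕ) : Type :=
  {k : Fin N → Fin n // ∀ i, (univ.filter fun l => k l = i).card = m i}

/-- A coloring composed with a permutation of the sites. -/
def Coloring.comp {n N : ℕ} {m : Fin n → ℕ} (k : Coloring N m) (σ : Equiv.Perm (Fin N)) :
    Coloring N m :=
  ⟨k.1 ∘ σ, fun i => (card_filter_comp_perm k.1 σ i).trans (k.2 i)⟩

/-- The matrix of the exchange Hamiltonian on the weight subspace with multiplicities `m`, in
the basis of the states `ε(k) |k⟩`, where `ε` is the inversion sign. -/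
noncomputable def signedMatrix {n N : ℕ} {b : Boundary} (J : Fin (numBonds b N) → ℝ)
    (m : Fin n → ℕ) : Matrix (Coloring N m) (Coloring N m) ℝ :=
  fun k k' => inversionSign k.1 * inversionSign k'.1 *
    ∑ l, if k.comp (Equiv.swap (leftSite l) (rightSite l)) = k' then J l else 0

theorem sum_signedMatrix_mul {n N : ℕ} {b : Boundary} (J : Fin (numBonds b N) → ℝ)
    {m : Fin n → ℕ} (ψ : StateSpace n N) (k : Coloring N m) :
    ∑ k', (signedMatrix J m k k' : ℂ) * (inversionSign k'.1 * ψ k'.1) =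
      inversionSign k.1 * exchangeHamiltonian n J ψ k.1 := by
  have h : ∀ k' : Coloring N m,
      (signedMatrix J m k k' : ℂ) * (inversionSign k'.1 * ψ k'.1) = ∑ l,
        if k.comp (Equiv.swap (leftSite l) (rightSite l)) = k' then
          (inversionSign k.1 : ℂ) * (J l * ψ k'.1) else 0 := by
    intro k'
    have h1 : (inversionSign k'.1 : ℂ) * inversionSign k'.1 = 1 := by
      exact_mod_cast inversionSign_mul_self k'.1
    have h2 : (signedMatrix J m k k' : ℂ) * (inversionSign k'.1 * ψ k'.1) =
        inversionSign k.1 * ((∑ l, if k.comp (Equiv.swap (leftSite l) (rightSite l)) = k'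
          then (J l : ℂ) else 0) * ψ k'.1) := by
      simp only [signedMatrix, Complex.ofReal_mul, Complex.ofReal_intCast, Complex.ofReal_sum]
      simp only [apply_ite Complex.ofReal, Complex.ofReal_zero]
      linear_combination inversionSign k.1 * (∑ l, if k.comp (Equiv.swap (leftSite l)
        (rightSite l)) = k' then (J l : ℂ) else 0) * ψ k'.1 * h1
    rw [h2, sum_mul, mul_sum]
    refine sum_congr rfl fun l _ => ?_
    split_ifs <;> simp
  simp only [h]
  rw [sum_comm, exchangeHamiltonian_apply, mul_sum]
  refine sum_congr rfl fun l _ => ?_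
  rw [sum_ite_eq, if_pos (mem_univ _)]
  rfl

theorem signedMatrix_isHermitian {n N : ℕ} {b : Boundary} (J : Fin (numBonds b N) → ℝ)
    (m : Fin n → ℕ) : (signedMatrix J m : Matrix (Coloring N m) (Coloring N m) ℝ).IsHermitian := by
  ext k k'
  have h : ∀ (k k' : Coloring N m) (u v : Fin N),
      k.comp (Equiv.swap u v) = k' → k'.comp (Equiv.swap u v) = k := by
    rintro k _ u v rfl
    refine Subtype.ext (funext fun x => ?_)
    simp [Coloring.comp]
  simp only [signedMatrix, conjTranspose_apply, star_trivial]
  rw [mul_comm ((inversionSign k'.1 : ℤ) : ℝ)]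
  congr 1
  exact sum_congr rfl fun l _ => if_congr ⟨h _ _ _ _, h _ _ _ _⟩ rfl rfl

section PerronFrobenius

variable {n N : ℕ} {b : Boundary} {J : Fin (numBonds b N) → ℝ} {m : Fin n → ℕ}

theorem inversionSign_mul_comp_bond
    (hparity : b = Boundary.periodic → ∀ i j, 0 < m i → 0 < m j → m i ≡ m j [MOD 2])
    (k : Coloring N m) (l : Fin (numBonds b N))
    (hk : k ≠ k.comp (Equiv.swap (leftSite l) (rightSite l))) :
    inversionSign k.1 * inversionSign (k.comp (Equiv.swap (leftSite l) (rightSite l))).1 = -1 := by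
  have hne : k.1 (leftSite l) ≠ k.1 (rightSite l) := by
    intro h
    refine hk (Subtype.ext (funext fun x => ?_))
    simp only [Coloring.comp, Function.comp_apply, Equiv.swap_apply_def]
    split_ifs with h1 h2
    · rw [h1, h]
    · rw [h2, h]
    · rfl
  have := inversionSign_comp_bond hparity k.1 k.2 l hne
  simp only [Coloring.comp, this, mul_neg, inversionSign_mul_self]

theorem signedMatrix_nonpos (hJ : ∀ l, 0 < J l)
    (hparity : b = Boundary.periodic → ∀ i j, 0 < m i → 0 < m j → m i ≡ m j [MOD 2])
    {k k' : Coloring N m} (hne : k ≠ k') : signedMatrix J m k k' ≤ 0 := by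
  rw [signedMatrix, mul_sum]
  refine sum_nonpos fun l _ => ?_
  split_ifs with h
  · subst h
    have := inversionSign_mul_comp_bond hparity k l hne
    rw [← Int.cast_mul, this]
    simpa using (hJ l).le
  · simp

theorem signedMatrix_comp_neg (hJ : ∀ l, 0 < J l)
    (hparity : b = Boundary.periodic → ∀ i j, 0 < m i → 0 < m j → m i ≡ m j [MOD 2])
    (k : Coloring N m) (l : Fin (numBonds b N))
    (hne : k ≠ k.comp (Equiv.swap (leftSite l) (rightSite l))) :
    signedMatrix J m k (k.comp (Equiv.swap (leftSite l) (rightSite l))) < 0 := by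
  rw [signedMatrix, ← Int.cast_mul, inversionSign_mul_comp_bond hparity k l hne]
  have : 0 < ∑ l', if k.comp (Equiv.swap (leftSite l') (rightSite l')) =
      k.comp (Equiv.swap (leftSite l) (rightSite l)) then J l' else 0 :=
    sum_pos' (fun l' _ => by split_ifs; exacts [(hJ l').le, le_rfl])
      ⟨l, mem_univ _, by simpa using hJ l⟩
  simpa using this

/-- The ground states in a weight subspace form a line, spanned by a state whose coefficients are
the inversion signs times positive numbers. -/
theorem IsRelativeGroundState.exists_signed_positive (hJ : ∀ l, 0 < J l)
    (hparity : b = Boundary.periodic → ∀ i j, 0 < m i → 0 < m j → m i ≡ m j [MOD 2])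
    {Ω : StateSpace n N} (hΩ : IsRelativeGroundState (exchangeHamiltonian n J) m Ω) :
    ∃ (E : ℝ) (a : Coloring N m → ℝ), exchangeHamiltonian n J Ω = (E : ℂ) • Ω ∧ (∀ k, 0 < a k) ∧
      ∀ ψ ∈ weightSpace N m, exchangeHamiltonian n J ψ = (E : ℂ) • ψ →
        ∃ c : ℂ, ∀ k : Coloring N m, ψ k.1 = c * (inversionSign k.1 * a k) := by
  obtain ⟨E, hmem, h0, hE, hmin⟩ := hΩ
  set A : Matrix (Coloring N m) (Coloring N m) ℝ := signedMatrix J m with hA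
  have hsq : ∀ k : Fin N → Fin n, (inversionSign k : ℂ) * inversionSign k = 1 := fun k => by
    exact_mod_cast inversionSign_mul_self k
  have hherm : A.IsHermitian := signedMatrix_isHermitian J m
  -- Each eigenvalue of `A` is an eigenvalue of the Hamiltonian on the weight subspace.
  have hle : ∀ (μ : ℝ) (v : Coloring N m → ℝ), v ≠ 0 → A *ᵥ v = μ • v → E ≤ μ := by
    intro μ v hv hAv
    classical
    let ψ : StateSpace n N := fun k =>
      if h : ∀ i, (univ.filter fun l => k l = i).card = m i
      then inversionSign k * (v ⟨k, h⟩ : ℂ) else 0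
    have hψ : ∀ k : Coloring N m, ψ k.1 = inversionSign k.1 * v k := fun k => dif_pos k.2
    have hψw : ψ ∈ weightSpace N m := mem_weightSpace_iff.2 fun k hk => dif_neg hk
    refine hmin μ ψ hψw ?_ ?_
    · obtain ⟨k, hk⟩ := Function.ne_iff.1 hv
      intro h
      have h1 : ψ k.1 = 0 := congrFun h k.1
      rw [hψ] at h1
      have h2 := hsq k.1
      rcases mul_eq_zero.1 h1 with h3 | h3
      · rw [h3] at h2
        simp at h2
      · exact hk (by simpa using h3)
    · funext k
      by_cases hk : ∀ i, (univ.filter fun l => k l = i).card = m i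
      · have h1 := sum_signedMatrix_mul J ψ (⟨k, hk⟩ : Coloring N m)
        have h2 : ∑ k', (A ⟨k, hk⟩ k' : ℂ) * (inversionSign k'.1 * ψ k'.1) =
            μ * v ⟨k, hk⟩ := by
          have := congrArg Complex.ofReal (congrFun hAv ⟨k, hk⟩)
          simp only [mulVec, dotProduct, Pi.smul_apply, smul_eq_mul, Complex.ofReal_sum,
            Complex.ofReal_mul] at this
          rw [← this]
          refine sum_congr rfl fun k' _ => ?_
          rw [hψ, ← mul_assoc (inversionSign k'.1 : ℂ), hsq, one_mul]
        rw [h2] at h1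
        rw [Pi.smul_apply, smul_eq_mul, hψ ⟨k, hk⟩]
        simp only at h1 ⊢
        linear_combination (-exchangeHamiltonian n J ψ k) * hsq k - (inversionSign k : ℂ) * h1
      · have hHψ : exchangeHamiltonian n J ψ ∈ weightSpace N m := by
          simp only [exchangeHamiltonian, LinearMap.sum_apply, LinearMap.smul_apply]
          exact Submodule.sum_mem _ fun l _ =>
            Submodule.smul_mem _ _ (permOp_mem_weightSpace hψw _)
        rw [mem_weightSpace_iff.1 hHψ k hk, Pi.smul_apply, mem_weightSpace_iff.1 hψw k hk,
          smul_zero]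
  set B : Matrix (Coloring N m) (Coloring N m) ℝ := A - E • 1 with hB
  have hBherm : B.IsHermitian := hherm.sub (by simp [IsHermitian])
  have hBoff : ∀ i j, i ≠ j → B i j = A i j := fun i j hij => by simp [hB, one_apply_ne hij]
  have hpsd : B.PosSemidef := by
    rw [hBherm.posSemidef_iff_eigenvalues_nonneg]
    intro j
    have h1 := hBherm.mulVec_eigenvectorBasis j
    have h2 := hle (hBherm.eigenvalues j + E) (hBherm.eigenvectorBasis j) ?_ ?_
    · simpa using h2
    · intro h
      exact hBherm.eigenvectorBasis.orthonormal.ne_zero j (by ext x; exact congrFun h x)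
    · have h3 : A = B + E • 1 := (sub_add_cancel _ _).symm
      rw [h3, add_mulVec, smul_mulVec, one_mulVec, h1, add_smul]
  have hconn : ∀ k k', Relation.ReflTransGen (fun i j => B i j < 0) k k' := by
    intro k k'
    obtain ⟨σ, hσ⟩ := exists_perm_comp_eq fun i => (k.2 i).trans (k'.2 i).symm
    have hσ' : k' = k.comp σ := Subtype.ext hσ
    rw [hσ']
    have hmem : σ ∈ Submonoid.closure (Set.range fun l : Fin (numBonds b N) =>
        Equiv.swap (leftSite l) (rightSite l)) := by
      rw [closure_bond_swaps]
      trivial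
    clear hσ hσ'
    induction hmem using Submonoid.closure_induction_right with
    | one => exact Relation.ReflTransGen.refl
    | mul_right σ _ s hs ih =>
      obtain ⟨l, rfl⟩ := hs
      have hcomp : k.comp (σ * Equiv.swap (leftSite l) (rightSite l)) =
          (k.comp σ).comp (Equiv.swap (leftSite l) (rightSite l)) := rfl
      by_cases h : k.comp σ = (k.comp σ).comp (Equiv.swap (leftSite l) (rightSite l))
      · rw [hcomp, ← h]
        exact ih
      · refine ih.tail ?_
        rw [hcomp, hBoff _ _ h]
        exact signedMatrix_comp_neg hJ hparity _ l h
  have hker : ∀ ψ : StateSpace n N, exchangeHamiltonian n J ψ = (E : ℂ) • ψ →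
      ∀ k, ∑ k', (B k k' : ℂ) * (inversionSign k'.1 * ψ k'.1) = 0 := by
    intro ψ hψ k
    have h1 := sum_signedMatrix_mul J ψ k
    rw [hψ, ← hA] at h1
    have h2 : ∀ k', (B k k' : ℂ) = A k k' - if k = k' then (E : ℂ) else 0 := by
      intro k'
      by_cases h : k = k' <;> simp [hB, one_apply, h]
    simp only [h2, sub_mul, sum_sub_distrib, h1, ite_mul, zero_mul, sum_ite_eq, mem_univ, if_true,
      Pi.smul_apply, smul_eq_mul]
    ring
  obtain ⟨a, hpos, ha⟩ := exists_pos_spanning_kernel hpsd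
    (fun i j hij => (hBoff i j hij).trans_le (signedMatrix_nonpos hJ hparity hij)) hconn
    (φ := fun k => inversionSign k.1 * Ω k.1) (hker Ω hE) (by
      intro h
      refine h0 (funext fun k => ?_)
      by_cases hk : ∀ i, (univ.filter fun l => k l = i).card = m i
      · have h1 : (inversionSign k : ℂ) * Ω k = 0 := congrFun h ⟨k, hk⟩
        have h2 := hsq k
        show Ω k = 0
        linear_combination (inversionSign k : ℂ) * h1 - Ω k * h2
      · exact mem_weightSpace_iff.1 hmem k hk)
  refine ⟨E, a, hE, hpos, fun ψ _ hψ => ?_⟩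
  obtain ⟨c, hc⟩ := ha (fun k => inversionSign k.1 * ψ k.1) (hker ψ hψ)
  refine ⟨c, fun k => ?_⟩
  have h1 : (inversionSign k.1 : ℂ) * ψ k.1 = c * a k := hc k
  linear_combination (inversionSign k.1 : ℂ) * h1 - ψ k.1 * hsq k.1

end PerronFrobenius

/-- A relative ground state of the exchange Hamiltonian lies in the multiplet sector: the ground
states form a line, so it is an eigenvector of `∑_t c_t c_t†`, and the eigenvalue is not zero, as
`c_t†` does not kill it when `t` is the column reading tableau. -/
theorem IsRelativeGroundState.mem_multipletSector {n N : ℕ} {b : Boundary}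
    {J : Fin (numBonds b N) → ℝ} (hJ : ∀ l, 0 < J l) {m : Fin n → ℕ} (hm : ∑ i, m i = N)
    (hparity : b = Boundary.periodic → ∀ i j, 0 < m i → 0 < m j → m i ≡ m j [MOD 2])
    (p : Equiv.Perm (Fin n)) (hp : Antitone (m ∘ p)) {Ω : StateSpace n N}
    (hΩ : IsRelativeGroundState (exchangeHamiltonian n J) m Ω) :
    Ω ∈ multipletSector n N (rowsDiagram (m ∘ p) hp) := by
  set Y := rowsDiagram (m ∘ p) hp
  obtain ⟨E, a, hE, hpos, hspan⟩ := hΩ.exists_signed_positive hJ hparity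
  obtain ⟨-, hmem, h0, -, -⟩ := hΩ
  obtain ⟨c, hc⟩ := hspan Ω hmem hE
  have hc0 : c ≠ 0 := by
    rintro rfl
    refine h0 (funext fun k => ?_)
    by_cases hk : ∀ i, (univ.filter fun l => k l = i).card = m i
    · simpa using hc ⟨k, hk⟩
    · exact mem_weightSpace_iff.1 hmem k hk
  have hTmem := tableauSum_mem_weightSpace Y hmem
  obtain ⟨d, hd⟩ := hspan (tableauSum n N Y Ω) hTmem
    (by rw [exchangeHamiltonian_tableauSum, hE, map_smul])
  have hT : tableauSum n N Y Ω = (d / c) • Ω := by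
    funext k
    rw [Pi.smul_apply, smul_eq_mul]
    by_cases hk : ∀ i, (univ.filter fun l => k l = i).card = m i
    · rw [hd ⟨k, hk⟩, hc ⟨k, hk⟩]
      field_simp
    · rw [mem_weightSpace_iff.1 hmem k hk, mem_weightSpace_iff.1 hTmem k hk, mul_zero]
  obtain ⟨t, k, hk, hrow, hcol⟩ := exists_tableau_and_coloring hm p hp
  have hne : rowSymmetrizer n t (colAntisymmetrizer n t Ω) ≠ 0 := by
    intro h
    have h1 := congrFun h k
    -- At the coloring `k` of the rows, the row sum repeats one value, and the terms of the column
    -- sum have the same sign; both sums contain the term of the identity.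
    rw [rowSymmetrizer_eq_fiberSum, fiberSum_apply, sum_congr rfl fun τ hτ => by
      rw [hrow τ (mem_filter.1 hτ).2, Pi.one_apply, one_mul], sum_const, Pi.zero_apply,
      nsmul_eq_mul] at h1
    have hS : 0 < ∑ τ : Equiv.Perm (Fin N) with ∀ l, (t (τ l)).1.2 = (t l).1.2,
        a (Coloring.comp ⟨k, hk⟩ τ) :=
      sum_pos (fun τ _ => hpos _) ⟨1, by simp⟩
    have h2 : colAntisymmetrizer n t Ω k = c * inversionSign k *
        ((∑ τ : Equiv.Perm (Fin N) with ∀ l, (t (τ l)).1.2 = (t l).1.2,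
          a (Coloring.comp ⟨k, hk⟩ τ) : ℝ) : ℂ) := by
      rw [colAntisymmetrizer_eq_fiberSum, fiberSum_apply, Complex.ofReal_sum, mul_sum]
      refine sum_congr rfl fun τ hτ => ?_
      have h3 : Ω (k ∘ τ) = _ := hc (Coloring.comp ⟨k, hk⟩ τ)
      have h4 : inversionSign (Coloring.comp ⟨k, hk⟩ τ : Coloring N m).1 = _ :=
        hcol τ (mem_filter.1 hτ).2
      have h5 : ((Equiv.Perm.sign τ : ℤ) : ℂ) * ((Equiv.Perm.sign τ : ℤ) : ℂ) = 1 := by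
        rw [← Int.cast_mul, ← Units.val_mul, Int.units_mul_self, Units.val_one, Int.cast_one]
      rw [h3, h4, Int.cast_mul]
      linear_combination c * inversionSign k * a (Coloring.comp ⟨k, hk⟩ τ) * h5
    have h6 : (inversionSign k : ℂ) ≠ 0 := by
      have := inversionSign_mul_self k
      exact_mod_cast left_ne_zero_of_mul_eq_one this
    rw [h2] at h1
    refine absurd h1 (mul_ne_zero (Nat.cast_ne_zero.2 (card_pos.2 ⟨1, by simp⟩).ne') ?_)
    exact mul_ne_zero (mul_ne_zero hc0 h6) (Complex.ofReal_ne_zero.2 hS.ne')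
  have hdc : d / c ≠ 0 := by
    intro h
    refine star_dotProduct_tableauSum_ne_zero t hne ?_
    rw [hT, h, zero_smul, dotProduct_zero]
  have hΩT : Ω = (d / c)⁻¹ • tableauSum n N Y Ω := by rw [hT, inv_smul_smul₀ hdc]
  rw [hΩT]
  exact Submodule.smul_mem _ _ (tableauSum_mem_multipletSector Y Ω)

end SuChain

theorem lemma2 (n N : ℕ) (b : SuChain.Boundary) (J : Fin (SuChain.numBonds b N) → ℝ)
    (hJ : ∀ l, 0 < J l) (m : Fin n → ℕ) (hm : ∑ i, m i = N)
    (hparity : b = SuChain.Boundary.periodic →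
      ∀ i j, 0 < m i → 0 < m j → m i ≡ m j [MOD 2])
    (p : Equiv.Perm (Fin n)) (hp : Antitone (m ∘ p)) :
    (∀ Ω : SuChain.StateSpace n N,
      SuChain.IsRelativeGroundState (SuChain.exchangeHamiltonian n J) m Ω →
        Ω ∈ SuChain.multipletSector n N (SuChain.rowsDiagram (m ∘ p) hp)) ∧
    (∀ X : Fin (n ^ 2 - 1) → Matrix (Fin n) (Fin n) ℂ, SuChain.IsSuBasis X →
      ∀ Ω : SuChain.StateSpace n N,
        SuChain.IsRelativeGroundState (SuChain.suHamiltonian X J) m Ω →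
          Ω ∈ SuChain.multipletSector n N (SuChain.rowsDiagram (m ∘ p) hp)) := by
  refine ⟨fun Ω hΩ => hΩ.mem_multipletSector hJ hm hparity p hp, fun X hX Ω hΩ => ?_⟩
  obtain ⟨c, hc⟩ := hX.exists_suHamiltonian_eq J
  rw [hc] at hΩ
  exact hΩ.of_add_smul_id.mem_multipletSector hJ hm hparity p hp
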